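/- A C*-ternary ring is a complex Banach space $A$ with a product $[\cdot,\cdot,\cdot]:A^3\to A$ that is linear in the outer variables and conjugate linear in the middle one, satisfies $[[abc]de]=[a[dcb]e]=[ab[cde]]$, $\|[xyz]\|\le\|x\|\|y\|\|z\|$ and $\|[xxx]\|=\|x\|^3$. A TRO is a norm closed subspace of some $B(H)$, $H$ a complex Hilbert space, closed under $xy^*z$. A Zettl decomposition of $A$ is a direct sum $A=A_1\oplus A_{-1}$ of closed subspaces, each closed under $[\cdot,\cdot,\cdot]$, such that there are a TRO $B_1$ and a surjective linear isometry $\varphi:A_1\to B_1$ with $\varphi([xyz])=\varphi(x)\varphi(y)^*\varphi(z)$, and a TRO $B_{-1}$ and a surjective linear isometry $\psi:A_{-1}\to B_{-1}$ with $\psi([xyz])=-\psi(x)\psi(y)^*\psi(z)$. A JB*-triple is a complex Banach space $A$ with a product $\{xyz\}=D(x,y)z$ that is linear in the outer variables, conjugate linear in the middle one, satisfies $\{xyz\}=\{zyx\}$ and $[D(x,y),D(a,b)]=D(\{xya\},b)-D(a,\{bxy\})$, and is such that every $D(x,x)$ is a bounded operator with $\|D(x,x)\|=\|x\|^2$, is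 hermitian (that is, $\|e^{isD(x,x)}\|=1$ for all real $s$, if $A\neq 0$), and has spectrum in $B(A)$ contained in $[0,\infty)$. Theorem. Every C*-ternary ring $A$ has a Zettl decomposition $A=A_1\oplus A_{-1}$, and for every such decomposition, $A_{-1}=0$ if and only if $A$ is a JB*-triple under the product $\{abc\}=\tfrac12([abc]+[cba])$. -/

import Mathlib

universe u

/-- The product `t x y z = [x y z]` makes the complex Banach space `A` a C*-ternary ring. -/
structure IsCStarTernaryRing {A : Type u} [NormedAddCommGroup A] [NormedSpace ℂ A]
    [CompleteSpace A] (t : A → A → A → A) : Prop where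
  add_left : ∀ x x' y z, t (x + x') y z = t x y z + t x' y z
  smul_left : ∀ (c : ℂ) x y z, t (c • x) y z = c • t x y z
  add_middle : ∀ x y y' z, t x (y + y') z = t x y z + t x y' z
  smul_middle : ∀ (c : ℂ) x y z, t x (c • y) z = (starRingEnd ℂ c) • t x y z
  add_right : ∀ x y z z', t x y (z + z') = t x y z + t x y z'
  smul_right : ∀ (c : ℂ) x y z, t x y (c • z) = c • t x y z
  assoc_right : ∀ a b c d e, t (t a b c) d e = t a b (t c d e)
  assoc_middle : ∀ a b c d e, t (t a b c) d e = t a (t d c b) e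
  norm_le : ∀ x y z, ‖t x y z‖ ≤ ‖x‖ * ‖y‖ * ‖z‖
  norm_cube : ∀ x, ‖t x x x‖ = ‖x‖ ^ 3

/-- A ternary ring of operators: a norm closed subspace of `B(H)` that is closed under the
product `x y* z`. -/
structure IsTRO {H : Type u} [NormedAddCommGroup H] [InnerProductSpace ℂ H] [CompleteSpace H]
    (B : Submodule ℂ (H →L[ℂ] H)) : Prop where
  isClosed : IsClosed (B : Set (H →L[ℂ] H))
  mul_mem : ∀ x ∈ B, ∀ y ∈ B, ∀ z ∈ B, x * star y * z ∈ B

/-- A sub-C*-ternary ring: a norm closed subspace that is closed under the ternary product. -/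
structure IsSubCStarTernaryRing {A : Type u} [NormedAddCommGroup A] [NormedSpace ℂ A]
    (t : A → A → A → A) (P : Submodule ℂ A) : Prop where
  isClosed : IsClosed (P : Set A)
  mem : ∀ x ∈ P, ∀ y ∈ P, ∀ z ∈ P, t x y z ∈ P

/-- `P` is a sub-C*-ternary ring that is isometrically isomorphic to a TRO. -/
def IsIsomorphicToTRO {A : Type u} [NormedAddCommGroup A] [NormedSpace ℂ A]
    (t : A → A → A → A) (P : Submodule ℂ A) : Prop :=
  ∃ hP : IsSubCStarTernaryRing t P,
    ∃ (H : Type u) (_ : NormedAddCommGroup H) (_ : InnerProductSpace ℂ H) (_ : CompleteSpace H)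
      (B : Submodule ℂ (H →L[ℂ] H)) (_ : IsTRO B) (φ : P ≃ₗᵢ[ℂ] B),
      ∀ x y z : P, (φ ⟨t x y z, hP.mem x x.2 y y.2 z z.2⟩ : H →L[ℂ] H)
        = (φ x : H →L[ℂ] H) * star (φ y : H →L[ℂ] H) * (φ z : H →L[ℂ] H)

/-- `P` is a sub-C*-ternary ring that is isometrically anti-isomorphic to a TRO; an
anti-isomorphism satisfies `φ [x y z] = - φ(x) φ(y)* φ(z)`. -/
def IsAntiIsomorphicToTRO {A : Type u} [NormedAddCommGroup A] [NormedSpace ℂ A]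
    (t : A → A → A → A) (P : Submodule ℂ A) : Prop :=
  ∃ hP : IsSubCStarTernaryRing t P,
    ∃ (H : Type u) (_ : NormedAddCommGroup H) (_ : InnerProductSpace ℂ H) (_ : CompleteSpace H)
      (B : Submodule ℂ (H →L[ℂ] H)) (_ : IsTRO B) (φ : P ≃ₗᵢ[ℂ] B),
      ∀ x y z : P, (φ ⟨t x y z, hP.mem x x.2 y y.2 z z.2⟩ : H →L[ℂ] H)
        = -((φ x : H →L[ℂ] H) * star (φ y : H →L[ℂ] H) * (φ z : H →L[ℂ] H))

/-- `A = P ⊕ N` is a Zettl decomposition: `P` is the TRO part `A₁` and `N` the anti-TRO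
part `A₋₁`. -/
structure IsZettlDecomposition {A : Type u} [NormedAddCommGroup A] [NormedSpace ℂ A]
    (t : A → A → A → A) (P N : Submodule ℂ A) : Prop where
  isCompl : IsCompl P N
  pos : IsIsomorphicToTRO t P
  neg : IsAntiIsomorphicToTRO t N

/-- A bounded operator `T` on `A` is hermitian if `‖exp(i s T)‖ = 1` for all real `s`. The value
`1` is written as the norm of the identity, which is `1` unless `A = 0`. -/
def IsHermitianOperator {A : Type u} [NormedAddCommGroup A] [NormedSpace ℂ A]
    (T : A →L[ℂ] A) : Prop :=
  ∀ s : ℝ, ‖NormedSpace.exp ((Complex.I * (s : ℂ)) • T)‖ = ‖ContinuousLinearMap.id ℂ A‖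

/-- The product `p x y z = {x y z} = D(x,y) z` makes the complex Banach space `A` a JB*-triple. -/
structure IsJBStarTriple {A : Type u} [NormedAddCommGroup A] [NormedSpace ℂ A]
    [CompleteSpace A] (p : A → A → A → A) : Prop where
  add_left : ∀ x x' y z, p (x + x') y z = p x y z + p x' y z
  smul_left : ∀ (c : ℂ) x y z, p (c • x) y z = c • p x y z
  add_middle : ∀ x y y' z, p x (y + y') z = p x y z + p x y' z
  smul_middle : ∀ (c : ℂ) x y z, p x (c • y) z = (starRingEnd ℂ c) • p x y z
  add_right : ∀ x y z z', p x y (z + z') = p x y z + p x y z'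
  smul_right : ∀ (c : ℂ) x y z, p x y (c • z) = c • p x y z
  comm : ∀ x y z, p x y z = p z y x
  /-- `[D(x,y), D(a,b)] = D({x y a}, b) - D(a, {b x y})`, evaluated at `z` -/
  jordan : ∀ x y a b z,
    p x y (p a b z) - p a b (p x y z) = p (p x y a) b z - p a (p b x y) z
  /-- `D(x,x)` is a bounded hermitian operator of norm `‖x‖²` whose spectrum in `B(A)` is
  contained in `[0, ∞)`. -/
  box : ∀ x, ∃ D : A →L[ℂ] A, (∀ z, D z = p x x z) ∧ ‖D‖ = ‖x‖ ^ 2 ∧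
    IsHermitianOperator D ∧ ∀ c ∈ spectrum ℂ D, ∃ r : ℝ, 0 ≤ r ∧ c = (r : ℂ)

/-- The symmetrized product `([a b c] + [c b a]) / 2`. -/
noncomputable def symmetrizedProduct {A : Type u} [NormedAddCommGroup A] [NormedSpace ℂ A]
    (t : A → A → A → A) (a b c : A) : A :=
  (1 / 2 : ℂ) • (t a b c + t c b a)

set_option linter.unusedSectionVars false

/-! ### Ternary rings and their C*-algebra of adjointable operators -/

namespace IsCStarTernaryRing

variable {A : Type u} [NormedAddCommGroup A] [NormedSpace ℂ A] [CompleteSpace A]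
  {t : A → A → A → A}

/-! The operators adjointable for `[· y e]` form a C*-algebra. It acts on `A`, and `⟨x,y⟩ = [x y ·]`
is a pairing on `A` with values in it. Up to sign, `A` is then a Hilbert module whose inner product
may be indefinite. Call `x` positive if `⟨x,x⟩ ≥ 0`, negative if `⟨x,x⟩ ≤ 0`.

The crux is that positivity does not depend on whether `x` multiplies from the left or the right: it
is a growth condition on norms of combinations of odd powers of `x`
(`isPositive_iff_norm_damped_le`). So `[y x x]` is both positive and negative when `x` is positive
and `y` negative, hence zero. This orthogonality makes the positive and negative elements closed
subspaces, and functional calculus of `⟨x,x⟩` splits every `x` between them. A GNS construction over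
all positive functionals represents the positive part as a TRO; negating the product treats the
other part.

The same norm criterion puts the summands of any Zettl decomposition inside these two parts. If all
elements are positive, left and right multiplication by `x, x` commute and generate contractions on
a half-plane, which gives the JB*-axioms. Conversely, if the triple is JB*, a negative `x` has the
spectrum of `D(x,x)` in both half-lines, so in `{0}`; but its spectral radius is at least `‖x‖²`. -/

theorem op (ht : IsCStarTernaryRing t) : IsCStarTernaryRing (fun x y z ↦ t z y x) where
  add_left x x' y z := ht.add_right z y x x'
  smul_left c x y z := ht.smul_right c z y x
  add_middle x y y' z := ht.add_middle z y y' x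
  smul_middle c x y z := ht.smul_middle c z y x
  add_right x y z z' := ht.add_left z z' y x
  smul_right c x y z := ht.smul_left c z y x
  assoc_right a b c d e := (ht.assoc_right e d c b a).symm
  assoc_middle a b c d e := by rw [← ht.assoc_right, ht.assoc_middle]
  norm_le x y z := by linarith [ht.norm_le z y x]
  norm_cube x := ht.norm_cube x

theorem neg_middle (ht : IsCStarTernaryRing t) (x y z : A) : t x (-y) z = -t x y z := by
  have := ht.smul_middle (-1) x y z
  simpa using this

theorem neg_left (ht : IsCStarTernaryRing t) (x y z : A) : t (-x) y z = -t x y z := by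
  have := ht.smul_left (-1) x y z
  simpa using this

theorem neg_right (ht : IsCStarTernaryRing t) (x y z : A) : t x y (-z) = -t x y z :=
  ht.op.neg_left z y x

theorem sub_middle (ht : IsCStarTernaryRing t) (x y y' z : A) :
    t x (y - y') z = t x y z - t x y' z := by
  rw [sub_eq_add_neg, ht.add_middle, ht.neg_middle, sub_eq_add_neg]

theorem sub_right (ht : IsCStarTernaryRing t) (x y z z' : A) :
    t x y (z - z') = t x y z - t x y z' := by
  rw [sub_eq_add_neg, ht.add_right, ht.neg_right, sub_eq_add_neg]

/-- Negation exchanges the two signs, so each result on positive elements also serves for negative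
ones. -/
theorem neg (ht : IsCStarTernaryRing t) : IsCStarTernaryRing (fun x y z ↦ -t x y z) where
  add_left x x' y z := by rw [ht.add_left, neg_add]
  smul_left c x y z := by rw [ht.smul_left, smul_neg]
  add_middle x y y' z := by rw [ht.add_middle, neg_add]
  smul_middle c x y z := by rw [ht.smul_middle, smul_neg]
  add_right x y z z' := by rw [ht.add_right, neg_add]
  smul_right c x y z := by rw [ht.smul_right, smul_neg]
  assoc_right a b c d e := by rw [ht.neg_left, ht.neg_right, ht.assoc_right]
  assoc_middle a b c d e := by rw [ht.neg_left, ht.neg_middle, ht.assoc_middle]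
  norm_le x y z := by rw [norm_neg]; exact ht.norm_le x y z
  norm_cube x := by rw [norm_neg, ht.norm_cube]

theorem eq_zero_of_self (ht : IsCStarTernaryRing t) {x : A} (h : t x x x = 0) : x = 0 := by
  have := ht.norm_cube x
  rw [h, norm_zero] at this
  simpa using this.symm

theorem eq_of_middle (ht : IsCStarTernaryRing t) {y y' : A} (h : ∀ x z, t x y z = t x y' z) :
    y = y' := by
  refine sub_eq_zero.mp (ht.eq_zero_of_self ?_)
  rw [ht.sub_middle, h, sub_self]

theorem eq_of_right (ht : IsCStarTernaryRing t) {z z' : A} (h : ∀ x y, t x y z = t x y z') :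
    z = z' := by
  refine sub_eq_zero.mp (ht.eq_zero_of_self ?_)
  rw [ht.sub_right, h, sub_self]

/-- The operator `z ↦ [x y z]`. -/
noncomputable def leftMul (ht : IsCStarTernaryRing t) (x y : A) : A →L[ℂ] A :=
  LinearMap.mkContinuous
    { toFun := t x y
      map_add' := ht.add_right x y
      map_smul' := fun c z ↦ ht.smul_right c x y z } (‖x‖ * ‖y‖) (ht.norm_le x y)

@[simp]
theorem leftMul_apply (ht : IsCStarTernaryRing t) (x y z : A) : ht.leftMul x y z = t x y z := rfl

theorem norm_leftMul_le (ht : IsCStarTernaryRing t) (x y : A) :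
    ‖ht.leftMul x y‖ ≤ ‖x‖ * ‖y‖ :=
  LinearMap.mkContinuous_norm_le _ (by positivity) _

theorem continuous_right (ht : IsCStarTernaryRing t) (x y : A) : Continuous (t x y) :=
  (ht.leftMul x y).continuous

theorem continuous_middle (ht : IsCStarTernaryRing t) (x z : A) :
    Continuous (fun y ↦ t x y z) := by
  refine continuous_iff_continuousAt.mpr fun y ↦ ?_
  rw [ContinuousAt, tendsto_iff_norm_sub_tendsto_zero]
  refine squeeze_zero (g := fun y' ↦ ‖x‖ * ‖y' - y‖ * ‖z‖) (fun _ ↦ norm_nonneg _)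
    (fun y' ↦ ?_) ?_
  · rw [← ht.sub_middle]; exact ht.norm_le _ _ _
  · have : Continuous fun y' : A ↦ ‖x‖ * ‖y' - y‖ * ‖z‖ := by fun_prop
    simpa using this.tendsto y

/-- `T'` is an adjoint of `T` with respect to the pairing `(y, e) ↦ [· y e]`. -/
def IsAdjoint (t : A → A → A → A) (T T' : A →L[ℂ] A) : Prop :=
  ∀ x y e, t x y (T e) = t x (T' y) e

/-- A product in the middle slot unfolds in reversed order, which brings `T'` from the last slot
into the middle one, where the hypothesis applies. -/
theorem IsAdjoint.symm (ht : IsCStarTernaryRing t) {T T' : A →L[ℂ] A} (h : IsAdjoint t T T') :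
    IsAdjoint t T' T := by
  intro w y e
  refine ht.eq_of_middle fun z v ↦ ?_
  rw [← ht.assoc_middle, ← h, ht.assoc_middle]

theorem IsAdjoint.unique (ht : IsCStarTernaryRing t) {T T' T'' : A →L[ℂ] A}
    (h : IsAdjoint t T T') (h' : IsAdjoint t T T'') : T' = T'' := by
  ext y
  exact ht.eq_of_middle fun x z ↦ (h x y z).symm.trans (h' x y z)

theorem IsAdjoint.add (ht : IsCStarTernaryRing t) {T T' S S' : A →L[ℂ] A}
    (h : IsAdjoint t T T') (h' : IsAdjoint t S S') : IsAdjoint t (T + S) (T' + S') :=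
  fun x y e ↦ by simp [ht.add_right, ht.add_middle, h x y e, h' x y e]

theorem IsAdjoint.mul {T T' S S' : A →L[ℂ] A}
    (h : IsAdjoint t T T') (h' : IsAdjoint t S S') : IsAdjoint t (T * S) (S' * T') :=
  fun x y e ↦ by simp [h x, h' x]

theorem IsAdjoint.smul (ht : IsCStarTernaryRing t) {T T' : A →L[ℂ] A} (c : ℂ)
    (h : IsAdjoint t T T') : IsAdjoint t (c • T) (starRingEnd ℂ c • T') :=
  fun x y e ↦ by simp [ht.smul_right, ht.smul_middle, h x y e]

theorem isAdjoint_one : IsAdjoint t 1 1 := fun _ _ _ ↦ rfl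

theorem isAdjoint_leftMul (ht : IsCStarTernaryRing t) (x y : A) :
    IsAdjoint t (ht.leftMul x y) (ht.leftMul y x) := fun z w e ↦ by
  simp only [leftMul_apply]
  rw [← ht.assoc_right, ht.assoc_middle]

/-- The cube identity gives `‖Tx‖³ = ‖[Tx, T'Tx, x]‖`; cancel one factor `‖Tx‖`. This becomes the
C*-identity. -/
theorem IsAdjoint.norm_sq_le (ht : IsCStarTernaryRing t) {T T' : A →L[ℂ] A}
    (h : IsAdjoint t T T') : ‖T‖ * ‖T‖ ≤ ‖T' * T‖ := by
  have key : ∀ x, ‖T x‖ ^ 2 ≤ ‖T' * T‖ * ‖x‖ ^ 2 := fun x ↦ by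
    rcases eq_or_ne (T x) 0 with h0 | h0
    · rw [h0]; simp; positivity
    have h1 : ‖T x‖ ^ 3 ≤ ‖T x‖ * ‖(T' * T) x‖ * ‖x‖ := by
      rw [← ht.norm_cube, h]; exact ht.norm_le _ _ _
    have h2 := (T' * T).le_opNorm x
    have h3 : 0 < ‖T x‖ := norm_pos_iff.mpr h0
    have h4 : ‖T x‖ ^ 2 ≤ ‖(T' * T) x‖ * ‖x‖ := by
      refine le_of_mul_le_mul_left ?_ h3
      linarith
    nlinarith [norm_nonneg x]
  have : ‖T‖ ≤ √‖T' * T‖ := by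
    refine T.opNorm_le_bound (Real.sqrt_nonneg _) fun x ↦ ?_
    refine (pow_le_pow_iff_left₀ (norm_nonneg _) (by positivity) two_ne_zero).mp ?_
    rw [mul_pow, Real.sq_sqrt (norm_nonneg _)]
    exact key x
  calc ‖T‖ * ‖T‖ ≤ √‖T' * T‖ * √‖T' * T‖ := by gcongr
    _ = _ := Real.mul_self_sqrt (norm_nonneg _)

theorem IsAdjoint.map_left (ht : IsCStarTernaryRing t) {T T' : A →L[ℂ] A}
    (h : IsAdjoint t T T') (x y e : A) : T (t x y e) = t (T x) y e := by
  refine ht.eq_of_right fun z w ↦ ?_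
  rw [h, ← ht.assoc_right, ← h, ht.assoc_right]

/-- The algebra of operators that are adjointable with respect to the pairing
`(y, e) ↦ [· y e]`. -/
def adjointableSubalgebra (ht : IsCStarTernaryRing t) : Subalgebra ℂ (A →L[ℂ] A) where
  carrier := {T | ∃ T', IsAdjoint t T T'}
  mul_mem' := fun ⟨_, h⟩ ⟨_, h'⟩ ↦ ⟨_, h.mul h'⟩
  add_mem' := fun ⟨_, h⟩ ⟨_, h'⟩ ↦ ⟨_, h.add ht h'⟩
  algebraMap_mem' c := ⟨starRingEnd ℂ c • 1, by
    rw [Algebra.algebraMap_eq_smul_one]; exact isAdjoint_one.smul ht c⟩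

/-- The C*-algebra of adjointable operators of a C*-ternary ring. -/
def Adjointable (ht : IsCStarTernaryRing t) : Type u := ht.adjointableSubalgebra

namespace Adjointable

variable (ht : IsCStarTernaryRing t)

noncomputable instance : NormedRing ht.Adjointable :=
  inferInstanceAs (NormedRing ht.adjointableSubalgebra)

noncomputable instance : NormedAlgebra ℂ ht.Adjointable :=
  inferInstanceAs (NormedAlgebra ℂ ht.adjointableSubalgebra)

/-- The inclusion of the adjointable operators into all bounded operators. -/
noncomputable def val : ht.Adjointable →ₐ[ℂ] (A →L[ℂ] A) := ht.adjointableSubalgebra.val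

variable {ht}

theorem val_injective : Function.Injective (val ht) := Subtype.val_injective

@[simp]
theorem norm_val (T : ht.Adjointable) : ‖val ht T‖ = ‖T‖ := rfl

theorem exists_isAdjoint (T : ht.Adjointable) : ∃ T', IsAdjoint t (val ht T) T' :=
  Subtype.property T

theorem exists_val_eq {T T' : A →L[ℂ] A} (h : IsAdjoint t T T') :
    ∃ S : ht.Adjointable, val ht S = T := ⟨⟨T, T', h⟩, rfl⟩

noncomputable instance : Star ht.Adjointable where
  star T := ⟨T.exists_isAdjoint.choose, _, T.exists_isAdjoint.choose_spec.symm ht⟩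

theorem isAdjoint_star (T : ht.Adjointable) : IsAdjoint t (val ht T) (val ht (star T)) :=
  T.exists_isAdjoint.choose_spec

theorem star_eq_of_isAdjoint {T S : ht.Adjointable} (h : IsAdjoint t (val ht T) (val ht S)) :
    star T = S :=
  val_injective (T.isAdjoint_star.unique ht h)

noncomputable instance : StarRing ht.Adjointable where
  star_involutive T := star_eq_of_isAdjoint (T.isAdjoint_star.symm ht)
  star_mul T S := star_eq_of_isAdjoint (by
    rw [map_mul, map_mul]; exact T.isAdjoint_star.mul S.isAdjoint_star)
  star_add T S := star_eq_of_isAdjoint (by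
    rw [map_add, map_add]; exact T.isAdjoint_star.add ht S.isAdjoint_star)

instance : CStarRing ht.Adjointable where
  norm_mul_self_le T := by
    have := T.isAdjoint_star.norm_sq_le ht
    rwa [← map_mul] at this

instance : StarModule ℂ ht.Adjointable where
  star_smul c T := star_eq_of_isAdjoint (by
    rw [map_smul, map_smul]; exact T.isAdjoint_star.smul ht c)

theorem isometry_val : Isometry (val ht) := isometry_subtype_coe

instance : CompleteSpace ht.Adjointable := by
  refine UniformSpace.complete_of_cauchySeq_tendsto fun u hu ↦ ?_
  -- The adjoints must converge too, for the limit to be adjointable; they do because the star is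
  -- isometric.
  have hstar : CauchySeq (fun n ↦ star (u n)) :=
    (starₗᵢ ℂ (E := ht.Adjointable)).isometry.uniformContinuous.comp_cauchySeq hu
  obtain ⟨T, hT⟩ := cauchySeq_tendsto_of_complete (isometry_val.uniformContinuous.comp_cauchySeq hu)
  obtain ⟨T', hT'⟩ := cauchySeq_tendsto_of_complete (isometry_val.uniformContinuous.comp_cauchySeq hstar)
  have hadj : IsAdjoint t T T' := fun x y e ↦ by
    have h1 := ((ht.continuous_right x y).tendsto _).comp
      (((ContinuousLinearMap.apply ℂ A e).continuous.tendsto T).comp hT)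
    have h2 := ((ht.continuous_middle x e).tendsto _).comp
      (((ContinuousLinearMap.apply ℂ A y).continuous.tendsto T').comp hT')
    refine tendsto_nhds_unique h1 (h2.congr fun n ↦ ?_)
    exact ((u n).isAdjoint_star x y e).symm
  obtain ⟨S, rfl⟩ := exists_val_eq (ht := ht) hadj
  exact ⟨S, isometry_val.isEmbedding.tendsto_nhds_iff.mpr hT⟩

noncomputable instance : CStarAlgebra ht.Adjointable where

noncomputable instance : PartialOrder ht.Adjointable := CStarAlgebra.spectralOrder _

instance : StarOrderedRing ht.Adjointable := CStarAlgebra.spectralOrderedRing _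

theorem map_left (T : ht.Adjointable) (x y e : A) :
    val ht T (t x y e) = t (val ht T x) y e := T.isAdjoint_star.map_left ht x y e

end Adjointable

end IsCStarTernaryRing

/-! ### Norm tests for positivity in a C*-algebra -/

section CStarAlgebra

variable {B : Type*} [CStarAlgebra B] [PartialOrder B] [StarOrderedRing B]

theorem CStarAlgebra.norm_algebraMap_sub_le {b : B} (hb : 0 ≤ b) {c : ℝ} (hc : ‖b‖ ≤ c) :
    ‖algebraMap ℝ B c - b‖ ≤ c := by
  have hc0 : 0 ≤ c := (norm_nonneg b).trans hc
  have h1 : b ≤ algebraMap ℝ B c := (CStarAlgebra.norm_le_iff_le_algebraMap b hc0 hb).mp hc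
  exact (CStarAlgebra.norm_le_iff_le_algebraMap _ hc0 (sub_nonneg.mpr h1)).mpr
    (sub_le_self _ hb)

/-- A spectral value `s < 0` makes the left side at least `(c - s)^(2n) |s|`, which outgrows `K
c^(2n)` because `(c - s)/c > 1`. -/
theorem CStarAlgebra.nonneg_of_norm_conjugate_pow_le {b : B} (hb : IsSelfAdjoint b) {c K : ℝ}
    (hc : 0 < c)
    (h : ∀ n : ℕ, ‖(algebraMap ℝ B c - b) ^ n * b * star ((algebraMap ℝ B c - b) ^ n)‖
      ≤ K * (c ^ n) ^ 2) : 0 ≤ b := by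
  rw [StarOrderedRing.nonneg_iff_spectrum_nonneg (R := ℝ) b hb]
  intro s hs
  by_contra! hs0
  have hsub : algebraMap ℝ B c - b = cfc (fun r : ℝ ↦ c - r) b := by
    rw [cfc_sub (fun _ : ℝ ↦ c) (fun r : ℝ ↦ r) b, cfc_const c b, cfc_id' ℝ b]
  have hcfc (n : ℕ) : (algebraMap ℝ B c - b) ^ n * b * star ((algebraMap ℝ B c - b) ^ n)
      = cfc (fun r : ℝ ↦ (c - r) ^ n * r * (c - r) ^ n) b := by
    have hsa : IsSelfAdjoint ((algebraMap ℝ B c - b) ^ n) :=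
      ((IsSelfAdjoint.algebraMap B (.all c)).sub hb).pow n
    rw [hsa.star_eq, hsub, cfc_mul (fun r : ℝ ↦ (c - r) ^ n * r) (fun r : ℝ ↦ (c - r) ^ n) b,
      cfc_mul (fun r : ℝ ↦ (c - r) ^ n) (fun r : ℝ ↦ r) b, cfc_pow (fun r : ℝ ↦ c - r) n b,
      cfc_id' ℝ b]
  have hle (n : ℕ) : ((c - s) ^ n) ^ 2 * (-s) ≤ K * (c ^ n) ^ 2 := by
    refine le_trans ?_ (h n)
    rw [hcfc n]
    refine le_trans (le_of_eq ?_)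
      (norm_apply_le_norm_cfc (fun r : ℝ ↦ (c - r) ^ n * r * (c - r) ^ n) b hs)
    have : 0 < c - s := by linarith
    rw [norm_mul, norm_mul, Real.norm_of_nonneg (by positivity), Real.norm_of_nonpos hs0.le]
    ring
  obtain ⟨n, hn⟩ := pow_unbounded_of_one_lt (K / (-s))
    (show 1 < ((c - s) / c) ^ 2 by
      refine one_lt_pow₀ ?_ two_ne_zero
      rw [one_lt_div hc]; linarith)
  rw [div_lt_iff₀ (by linarith), ← pow_mul, mul_comm 2 n, pow_mul, div_pow, div_pow,
    div_mul_eq_mul_div, lt_div_iff₀ (by positivity)] at hn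
  exact absurd (hle n) (not_le.mpr hn)

end CStarAlgebra

/-! ### The operator-valued pairing; positive elements and orthogonality -/

namespace IsCStarTernaryRing

variable {A : Type u} [NormedAddCommGroup A] [NormedSpace ℂ A] [CompleteSpace A]
  {t : A → A → A → A}

open Adjointable

/-- The operator `z ↦ [x y z]` as an element of the C*-algebra of adjointable operators. -/
noncomputable def pairing (ht : IsCStarTernaryRing t) (x y : A) : ht.Adjointable :=
  ⟨ht.leftMul x y, _, ht.isAdjoint_leftMul x y⟩

variable (ht : IsCStarTernaryRing t)

@[simp]
theorem val_pairing (x y : A) : val ht (ht.pairing x y) = ht.leftMul x y := rfl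

theorem val_pairing_apply (x y z : A) : val ht (ht.pairing x y) z = t x y z := rfl

theorem star_pairing (x y : A) : star (ht.pairing x y) = ht.pairing y x :=
  star_eq_of_isAdjoint (ht.isAdjoint_leftMul x y)

theorem isSelfAdjoint_pairing (x : A) : IsSelfAdjoint (ht.pairing x x) := ht.star_pairing x x

theorem pairing_add_left (x x' y : A) :
    ht.pairing (x + x') y = ht.pairing x y + ht.pairing x' y :=
  val_injective (by ext; simp [ht.add_left])

theorem pairing_smul_left (c : ℂ) (x y : A) : ht.pairing (c • x) y = c • ht.pairing x y :=
  val_injective (by ext; simp [ht.smul_left])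

theorem pairing_add_right (x y y' : A) :
    ht.pairing x (y + y') = ht.pairing x y + ht.pairing x y' :=
  val_injective (by ext; simp [ht.add_middle])

theorem pairing_smul_right (c : ℂ) (x y : A) :
    ht.pairing x (c • y) = starRingEnd ℂ c • ht.pairing x y :=
  val_injective (by ext; simp [ht.smul_middle])

theorem mul_pairing (T : ht.Adjointable) (x y : A) :
    T * ht.pairing x y = ht.pairing (val ht T x) y :=
  val_injective (by ext z; simp [T.map_left])

theorem pairing_mul (T : ht.Adjointable) (x y : A) :
    ht.pairing x y * T = ht.pairing x (val ht (star T) y) := by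
  rw [← star_star (ht.pairing x y * T), star_mul, star_pairing, mul_pairing, star_pairing]

theorem pairing_map_map (T : ht.Adjointable) (x : A) :
    ht.pairing (val ht T x) (val ht T x) = T * ht.pairing x x * star T := by
  rw [mul_pairing, pairing_mul, star_star]

theorem norm_pairing_le (x y : A) : ‖ht.pairing x y‖ ≤ ‖x‖ * ‖y‖ := ht.norm_leftMul_le x y

theorem norm_pairing_self (x : A) : ‖ht.pairing x x‖ = ‖x‖ ^ 2 := by
  refine le_antisymm ((ht.norm_pairing_le x x).trans_eq (sq _).symm) ?_
  rcases eq_or_ne x 0 with rfl | hx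
  · simp
  have h1 : ‖t x x x‖ ≤ ‖ht.pairing x x‖ * ‖x‖ := by
    rw [← ht.val_pairing_apply, ← norm_val]; exact ContinuousLinearMap.le_opNorm _ _
  rw [ht.norm_cube, pow_succ] at h1
  exact le_of_mul_le_mul_right h1 (norm_pos_iff.mpr hx)

theorem norm_sq_val_apply (T : ht.Adjointable) (x : A) :
    ‖val ht T x‖ ^ 2 = ‖T * ht.pairing x x * star T‖ := by
  rw [← ht.norm_pairing_self, pairing_map_map]

theorem norm_val_apply_le (T : ht.Adjointable) (x : A) : ‖val ht T x‖ ≤ ‖T‖ * ‖x‖ :=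
  (val ht T).le_opNorm x

theorem pairing_self_eq_zero {x : A} (h : ht.pairing x x = 0) : x = 0 := by
  have := ht.norm_pairing_self x
  rw [h, norm_zero] at this
  simpa using this.symm

theorem continuous_pairing_self : Continuous fun x ↦ ht.pairing x x := by
  refine continuous_iff_continuousAt.mpr fun x ↦ ?_
  rw [ContinuousAt, tendsto_iff_norm_sub_tendsto_zero]
  refine squeeze_zero (g := fun y ↦ ‖y - x‖ * ‖y‖ + ‖x‖ * ‖y - x‖) (fun _ ↦ norm_nonneg _)
    (fun y ↦ ?_) ?_
  · have : ht.pairing y y - ht.pairing x x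
        = ht.pairing (y - x) y + ht.pairing x (y - x) := by
      have h1 := ht.pairing_add_left (y - x) x y
      have h2 := ht.pairing_add_right x (y - x) x
      rw [sub_add_cancel] at h1 h2
      rw [h1, h2]; abel
    rw [this]
    exact (norm_add_le _ _).trans (add_le_add (ht.norm_pairing_le _ _) (ht.norm_pairing_le _ _))
  · have : Continuous fun y : A ↦ ‖y - x‖ * ‖y‖ + ‖x‖ * ‖y - x‖ := by fun_prop
    simpa using this.tendsto x

/-- An element `x` is positive if the operator `z ↦ [x x z]` is positive. -/
def IsPositive (x : A) : Prop := 0 ≤ ht.pairing x x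

/-- The sequence `(‖x‖² - D)ⁿ x` where `D z = [x x z]`. -/
noncomputable def damped (t : A → A → A → A) (x : A) (n : ℕ) : A :=
  (fun z ↦ ((‖x‖ ^ 2 : ℝ) : ℂ) • z - t x x z)^[n] x

theorem damped_succ (x : A) (n : ℕ) :
    damped t x (n + 1) = ((‖x‖ ^ 2 : ℝ) : ℂ) • damped t x n - t x x (damped t x n) :=
  Function.iterate_succ_apply' _ _ _

theorem damped_eq (x : A) (n : ℕ) :
    damped t x n
      = val ht ((algebraMap ℝ ht.Adjointable (‖x‖ ^ 2) - ht.pairing x x) ^ n) x := by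
  induction n with
  | zero => simp [damped]
  | succ n ih =>
    rw [damped_succ, ih, pow_succ' _ n, map_mul, mul_apply_eq_comp]
    generalize val ht (_ ^ n) x = y
    rw [Algebra.algebraMap_eq_smul_one, ← Complex.coe_smul]
    simp

/-- The condition mentions only norms and powers of `x`, so it survives reversal of the product and
isometric isomorphism. If `b = ⟨x,x⟩ ≥ 0`, then `‖x‖² - b` has norm at most `‖x‖²`; conversely,
negative spectrum of `b` would make the iterates grow too fast. -/
theorem isPositive_iff_norm_damped_le (x : A) :
    ht.IsPositive x ↔ ∀ n, ‖damped t x n‖ ≤ (‖x‖ ^ 2) ^ n * ‖x‖ := by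
  refine ⟨fun hx n ↦ ?_, fun h ↦ ?_⟩
  · rw [ht.damped_eq]
    have h1 := CStarAlgebra.norm_algebraMap_sub_le hx (ht.norm_pairing_self x).le
    generalize algebraMap ℝ ht.Adjointable (‖x‖ ^ 2) - ht.pairing x x = S at h1
    induction n with
    | zero => simp
    | succ n ih =>
      rw [pow_succ', map_mul, mul_apply_eq_comp, pow_succ', mul_assoc]
      exact (ht.norm_val_apply_le _ _).trans (by gcongr)
  · rcases eq_or_ne x 0 with rfl | hx
    · have : ht.pairing (0 : A) 0 = 0 := by
        rw [← norm_eq_zero, norm_pairing_self]; simp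
      exact this.ge
    refine CStarAlgebra.nonneg_of_norm_conjugate_pow_le (K := ‖x‖ ^ 2)
      (ht.isSelfAdjoint_pairing x) (c := ‖x‖ ^ 2) (by positivity) fun n ↦ ?_
    rw [← norm_sq_val_apply, ← damped_eq]
    calc ‖damped t x n‖ ^ 2 ≤ ((‖x‖ ^ 2) ^ n * ‖x‖) ^ 2 := by gcongr; exact h n
      _ = _ := by ring

/-- The iterates are combinations of odd powers of `x`, on which left and right multiplication by
`x, x` agree. -/
theorem damped_op (ht : IsCStarTernaryRing t) (x : A) (n : ℕ) : damped (fun x y z ↦ t z y x) x n = damped t x n := by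
  have hcomm (n : ℕ) : t x x (damped t x n) = t (damped t x n) x x := by
    induction n with
    | zero => rfl
    | succ n ih =>
      rw [damped_succ, ht.sub_right, ht.smul_right, ih, ← ht.assoc_right, ih]
      have := ht.op.sub_right x x (((‖x‖ ^ 2 : ℝ) : ℂ) • damped t x n) (t (damped t x n) x x)
      rw [this, ht.smul_left]
  induction n with
  | zero => rfl
  | succ n ih => rw [damped_succ, damped_succ, ih, hcomm]

theorem isPositive_op_iff (x : A) : ht.op.IsPositive x ↔ ht.IsPositive x := by
  simp only [isPositive_iff_norm_damped_le, ht.damped_op]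

variable {ht}

theorem IsPositive.map {x : A} (hx : ht.IsPositive x) (T : ht.Adjointable) :
    ht.IsPositive (val ht T x) := by
  rw [IsPositive, pairing_map_map]
  exact star_right_conjugate_nonneg hx T

theorem IsPositive.mul_left {z : A} (hz : ht.IsPositive z) (x y : A) : ht.IsPositive (t x y z) :=
  hz.map (ht.pairing x y)

theorem IsPositive.mul_right {x : A} (hx : ht.IsPositive x) (y z : A) :
    ht.IsPositive (t x y z) := by
  rw [← isPositive_op_iff] at hx ⊢
  exact hx.mul_left z y

variable (ht)

/-- The algebras of `t` and `-t` are different types. Expressing positivity by operators on `A` lets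
the two be compared, since both products have the same adjoints. -/
theorem Adjointable.nonneg_iff_exists_isAdjoint {T : ht.Adjointable} :
    0 ≤ T ↔ ∃ S S' : A →L[ℂ] A, IsAdjoint t S S' ∧ val ht T = S' * S := by
  rw [CStarAlgebra.nonneg_iff_eq_star_mul_self]
  refine ⟨?_, ?_⟩
  · rintro ⟨S, rfl⟩
    exact ⟨_, _, S.isAdjoint_star, map_mul _ _ _⟩
  · rintro ⟨S, S', h, hT⟩
    obtain ⟨S, rfl⟩ := exists_val_eq (ht := ht) h
    refine ⟨S, val_injective ?_⟩
    rw [hT, h.unique ht S.isAdjoint_star, map_mul]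

theorem isPositive_neg_iff (x : A) : ht.neg.IsPositive x ↔ ht.pairing x x ≤ 0 := by
  rw [← neg_nonneg, IsPositive, nonneg_iff_exists_isAdjoint, nonneg_iff_exists_isAdjoint]
  have h1 (S S' : A →L[ℂ] A) : IsAdjoint (fun x y z ↦ -t x y z) S S' ↔ IsAdjoint t S S' := by
    simp [IsAdjoint]
  have h2 : val ht.neg (ht.neg.pairing x x) = val ht (-ht.pairing x x) := by
    ext z; simp
  simp only [h1, h2]

variable {ht}

/-- `[y x x]` inherits positivity from its last factor and negativity from its first, so it
vanishes; then `⟨x,y⟩* ⟨x,y⟩ = ⟨[y x x], y⟩ = 0`. -/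
theorem IsPositive.pairing_eq_zero {x y : A} (hx : ht.IsPositive x) (hy : ht.neg.IsPositive y) :
    ht.pairing x y = 0 := by
  have h1 : 0 ≤ ht.pairing (t y x x) (t y x x) := hx.mul_left y x
  have h2 : ht.pairing (t y x x) (t y x x) ≤ 0 := by
    have := hy.mul_right x x
    rw [isPositive_neg_iff, ← neg_one_smul ℂ, pairing_smul_left, pairing_smul_right] at this
    simpa using this
  have h3 : t y x x = 0 := ht.pairing_self_eq_zero (le_antisymm h2 h1)
  rw [← CStarRing.star_mul_self_eq_zero_iff, star_pairing, mul_pairing, val_pairing_apply, h3,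
    ← zero_smul ℂ (0 : A), pairing_smul_left, zero_smul]

theorem isPositive_val_posPart (x : A) : ht.IsPositive (val ht (ht.pairing x x)⁺ x) := by
  have hb := ht.isSelfAdjoint_pairing x
  rw [IsPositive, pairing_map_map]
  generalize ht.pairing x x = b at hb
  -- Hence `b⁺ b b⁺ = (b⁺)³ ≥ 0`.
  have h1 : b⁺ * b = b⁺ * b⁺ := by
    nth_rw 2 [← CFC.posPart_sub_negPart b]
    rw [mul_sub, CFC.posPart_mul_negPart, sub_zero]
  rw [(CFC.posPart_nonneg b).isSelfAdjoint.star_eq, h1]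
  simpa [pow_succ] using CStarAlgebra.pow_nonneg (CFC.posPart_nonneg b) 3

theorem isPositive_neg_val_negPart (x : A) :
    ht.neg.IsPositive (val ht (ht.pairing x x)⁻ x) := by
  have hb := ht.isSelfAdjoint_pairing x
  rw [ht.isPositive_neg_iff, pairing_map_map]
  generalize ht.pairing x x = b at hb
  have h1 : b⁻ * b = -(b⁻ * b⁻) := by
    nth_rw 2 [← CFC.posPart_sub_negPart b]
    rw [mul_sub, CFC.negPart_mul_posPart, zero_sub]
  rw [(CFC.negPart_nonneg b).isSelfAdjoint.star_eq, h1, neg_mul, neg_nonpos]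
  simpa [pow_succ] using CStarAlgebra.pow_nonneg (CFC.negPart_nonneg b) 3

/-- With `b = ⟨x+y, x+y⟩`, the element `b⁻(x+y)` is negative, so orthogonal to `x` and `y`. Thus `b⁻
b = 0`, that is `(b⁻)² = 0`. -/
theorem IsPositive.add {x y : A} (hx : ht.IsPositive x) (hy : ht.IsPositive y) :
    ht.IsPositive (x + y) := by
  have hb := ht.isSelfAdjoint_pairing (x + y)
  have hn := ht.isPositive_neg_val_negPart (x + y)
  have h0 : ht.pairing (val ht (ht.pairing (x + y) (x + y))⁻ (x + y)) (x + y) = 0 := by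
    rw [← star_pairing, pairing_add_left, hx.pairing_eq_zero hn, hy.pairing_eq_zero hn,
      add_zero, star_zero]
  rw [← mul_pairing] at h0
  rw [IsPositive]
  generalize ht.pairing (x + y) (x + y) = b at hb h0
  have h1 : b⁻ * b = -(b⁻ * b⁻) := by
    nth_rw 2 [← CFC.posPart_sub_negPart b]
    rw [mul_sub, CFC.negPart_mul_posPart, zero_sub]
  rw [h1, neg_eq_zero] at h0
  rw [← CFC.negPart_eq_zero_iff b, ← CStarRing.star_mul_self_eq_zero_iff,
    (CFC.negPart_nonneg b).isSelfAdjoint.star_eq, h0]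

theorem IsPositive.smul {x : A} (hx : ht.IsPositive x) (c : ℂ) : ht.IsPositive (c • x) := by
  simpa using hx.map (c • (1 : ht.Adjointable))

/-! ### The positive and negative parts are complementary -/

variable (ht)

/-- The positive part of a C*-ternary ring. -/
def positivePart : Submodule ℂ A where
  carrier := {x | ht.IsPositive x}
  zero_mem' := by
    have : ht.pairing (0 : A) 0 = 0 := by rw [← norm_eq_zero, norm_pairing_self]; simp
    exact this.ge
  add_mem' hx hy := hx.add hy
  smul_mem' c _ hx := hx.smul c

/-- The negative part of a C*-ternary ring. -/
def negativePart : Submodule ℂ A := ht.neg.positivePart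

variable {ht}

theorem mem_positivePart {x : A} : x ∈ ht.positivePart ↔ ht.IsPositive x := Iff.rfl

theorem mem_negativePart {x : A} : x ∈ ht.negativePart ↔ ht.neg.IsPositive x := Iff.rfl

variable (ht)

theorem isSubCStarTernaryRing_positivePart : IsSubCStarTernaryRing t ht.positivePart where
  isClosed := CStarAlgebra.isClosed_nonneg.preimage ht.continuous_pairing_self
  mem x _ y _ _ hz := IsPositive.mul_left hz x y

theorem isClosed_negativePart : IsClosed (ht.negativePart : Set A) :=
  ht.neg.isSubCStarTernaryRing_positivePart.isClosed

theorem map_mem_negativePart (T : ht.Adjointable) {x : A} (hx : x ∈ ht.negativePart) :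
    val ht T x ∈ ht.negativePart := by
  rw [mem_negativePart, ht.isPositive_neg_iff] at hx ⊢
  rw [pairing_map_map]
  have := star_right_conjugate_nonneg (neg_nonneg.mpr hx) T
  simpa using this

theorem disjoint_positivePart_negativePart : Disjoint ht.positivePart ht.negativePart := by
  rw [Submodule.disjoint_def]
  intro x hx hx'
  exact ht.pairing_self_eq_zero (IsPositive.pairing_eq_zero hx hx')

/-- By orthogonality `⟨p,p⟩ = ⟨p,p+n⟩`, so `‖p‖² ≤ ‖p‖ ‖p+n‖`. The bound makes the sum of the two
parts closed. -/
theorem norm_le_norm_add_of_mem {p n : A} (hp : p ∈ ht.positivePart)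
    (hn : n ∈ ht.negativePart) : ‖p‖ ≤ ‖p + n‖ ∧ ‖n‖ ≤ ‖p + n‖ := by
  have h0 : ht.pairing p n = 0 := IsPositive.pairing_eq_zero hp hn
  have aux {x y : A} (h : ht.pairing x x = ht.pairing x y) : ‖x‖ ≤ ‖y‖ := by
    rcases eq_or_ne x 0 with rfl | hx
    · simp
    have := ht.norm_pairing_le x y
    rw [← h, norm_pairing_self, sq] at this
    exact le_of_mul_le_mul_left this (norm_pos_iff.mpr hx)
  refine ⟨aux ?_, aux ?_⟩
  · rw [pairing_add_right, h0, add_zero]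
  · rw [pairing_add_right, ← ht.star_pairing p n, h0, star_zero, zero_add]

theorem isClosed_positivePart_sup_negativePart :
    IsClosed ((ht.positivePart ⊔ ht.negativePart : Submodule ℂ A) : Set A) := by
  have : CompleteSpace ht.positivePart :=
    ht.isSubCStarTernaryRing_positivePart.isClosed.completeSpace_coe
  have : CompleteSpace ht.negativePart := ht.isClosed_negativePart.completeSpace_coe
  let f : ht.positivePart × ht.negativePart →L[ℂ] A :=
    ht.positivePart.subtypeL.coprod ht.negativePart.subtypeL
  have hf : AntilipschitzWith 1 f := f.antilipschitz_of_bound fun ⟨p, n⟩ ↦ by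
    have := ht.norm_le_norm_add_of_mem p.2 n.2
    simpa [f, Prod.norm_def] using this
  have hr := hf.isClosed_range f.uniformContinuous
  have hrange : Set.range f = (f.toLinearMap.range : Set A) := rfl
  rw [hrange] at hr
  simpa [f, LinearMap.range_coprod] using hr

theorem isCompl_positivePart_negativePart : IsCompl ht.positivePart ht.negativePart := by
  refine ⟨ht.disjoint_positivePart_negativePart, codisjoint_iff.mpr (eq_top_iff.mpr ?_)⟩
  intro x _
  refine ht.isClosed_positivePart_sup_negativePart.closure_subset_iff.mpr subset_rfl
    (Metric.mem_closure_iff.mpr fun ε hε ↦ ?_)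
  set b := ht.pairing x x with hbdef
  have hb : IsSelfAdjoint b := ht.isSelfAdjoint_pairing x
  -- The error below will satisfy `‖hx‖² ≤ δ`, so any `δ < ε²` serves.
  set δ : ℝ := ε ^ 2 / 2 with hδ
  have hδ0 : 0 < δ := by positivity
  have hden (s : ℝ) : δ ^ 2 + s ^ 2 ≠ 0 := by positivity
  have hcont : Continuous fun s : ℝ ↦ δ ^ 2 / (δ ^ 2 + s ^ 2) :=
    continuous_const.div (by fun_prop) hden
  have hcont' : Continuous fun s : ℝ ↦ s / (δ ^ 2 + s ^ 2) :=
    continuous_id.div (by fun_prop) hden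
  have hcont₁ : Continuous fun s : ℝ ↦ δ ^ 2 / (δ ^ 2 + s ^ 2) * s := hcont.mul continuous_id
  have hcont₁' : Continuous fun s : ℝ ↦ s / (δ ^ 2 + s ^ 2) * s := hcont'.mul continuous_id
  -- `g` is a regularized inverse of `b` and `h = 1 - g b` the defect. Then `x = hx + g b⁺x - g
  -- b⁻x`, whose last two terms lie in the two parts.
  set h := cfc (fun s : ℝ ↦ δ ^ 2 / (δ ^ 2 + s ^ 2)) b with hh
  set g := cfc (fun s : ℝ ↦ s / (δ ^ 2 + s ^ 2)) b with hg
  have hsum : h + g * b = 1 := by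
    have hgb : g * b = cfc (fun s : ℝ ↦ s / (δ ^ 2 + s ^ 2) * s) b := by
      rw [cfc_mul _ _ b hcont'.continuousOn, cfc_id' ℝ b]
    rw [hgb, hh, ← cfc_add b _ _ hcont.continuousOn hcont₁'.continuousOn,
      ← cfc_one ℝ b]
    refine cfc_congr fun s _ ↦ ?_
    have := hden s
    simp only [Pi.one_apply]
    field_simp
  have hsmall : ‖h * b * star h‖ ≤ δ := by
    have hsa : IsSelfAdjoint h := cfc_predicate _ b
    rw [hsa.star_eq]
    have hhb : h * b = cfc (fun s : ℝ ↦ δ ^ 2 / (δ ^ 2 + s ^ 2) * s) b := by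
      rw [cfc_mul _ _ b hcont.continuousOn, cfc_id' ℝ b]
    rw [hhb, hh, ← cfc_mul _ _ b hcont₁.continuousOn hcont.continuousOn]
    refine norm_cfc_le hδ0.le fun s _ ↦ ?_
    have h1 : 0 < δ ^ 2 + s ^ 2 := by positivity
    have h2 : δ ^ 2 / (δ ^ 2 + s ^ 2) ≤ 1 := by rw [div_le_one h1]; nlinarith
    have h3 : δ ^ 2 / (δ ^ 2 + s ^ 2) * |s| ≤ δ := by
      rw [div_mul_eq_mul_div, div_le_iff₀ h1]
      have : δ * |s| ≤ δ ^ 2 + s ^ 2 := by nlinarith [sq_nonneg (δ - |s|), sq_abs s]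
      nlinarith
    have h4 : 0 ≤ δ ^ 2 / (δ ^ 2 + s ^ 2) := by positivity
    rw [norm_mul, norm_mul, Real.norm_of_nonneg h4, Real.norm_eq_abs]
    calc _ ≤ δ * 1 := by gcongr
      _ = δ := mul_one δ
  refine ⟨val ht g (val ht b⁺ x) + -val ht g (val ht b⁻ x), ?_, ?_⟩
  · refine Submodule.add_mem_sup (IsPositive.map (isPositive_val_posPart x) g)
      (Submodule.neg_mem _ (ht.map_mem_negativePart g (isPositive_neg_val_negPart x)))
  · have hx : x - (val ht g (val ht b⁺ x) + -val ht g (val ht b⁻ x)) = val ht h x := by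
      have h1 := congrArg (fun T ↦ val ht T x) hsum
      have h2 : g * b = g * b⁺ - g * b⁻ := by rw [← mul_sub, CFC.posPart_sub_negPart b]
      simp only [h2, map_add, map_sub, map_mul, map_one, add_apply,
        sub_apply, mul_apply_eq_comp, one_apply_eq_self] at h1
      nth_rw 1 [← h1]
      abel
    rw [dist_eq_norm, hx]
    refine lt_of_pow_lt_pow_left₀ 2 hε.le ?_
    rw [norm_sq_val_apply]
    exact hsmall.trans_lt (by rw [hδ]; linarith [pow_pos hε 2])

end IsCStarTernaryRing

/-! ### Norming states of a C*-algebra -/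

section CStarAlgebra

variable {B : Type*} [CStarAlgebra B] [PartialOrder B] [StarOrderedRing B]

open scoped ComplexOrder

theorem CStarAlgebra.norm_one_add_of_nonneg [Nontrivial B] {a : B} (ha : 0 ≤ a) :
    ‖1 + a‖ = 1 + ‖a‖ := by
  refine le_antisymm ((norm_add_le _ _).trans_eq (by simp)) ?_
  have h1 : 1 + a = cfc (fun s : ℝ ↦ 1 + s) a := by
    have hs : IsSelfAdjoint a := .of_nonneg ha
    rw [cfc_const_add 1 (fun s : ℝ ↦ s) a, cfc_id' ℝ a, map_one]
  have h2 := norm_apply_le_norm_cfc (fun s : ℝ ↦ 1 + s) a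
    (CStarAlgebra.norm_mem_spectrum_of_nonneg ha)
  rw [h1]
  exact (Real.le_norm_self _).trans h2

/-- The spectrum lies in `[0, ‖b‖]`, whose points farthest from `‖b‖/2 + ik` are the endpoints. -/
theorem CStarAlgebra.norm_sub_smul_one_le {b : B} (hb : 0 ≤ b) (k : ℝ) :
    ‖b - (((‖b‖ / 2 : ℝ) : ℂ) + k * Complex.I) • (1 : B)‖ ≤ √((‖b‖ / 2) ^ 2 + k ^ 2) := by
  have hs : IsSelfAdjoint b := .of_nonneg hb
  have hn : IsStarNormal b := hs.isStarNormal
  have h1 : b - (((‖b‖ / 2 : ℝ) : ℂ) + k * Complex.I) • (1 : B)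
      = cfc (fun w : ℂ ↦ w - (((‖b‖ / 2 : ℝ) : ℂ) + k * Complex.I)) b := by
    rw [cfc_sub (fun w : ℂ ↦ w) (fun _ ↦ ((‖b‖ / 2 : ℝ) : ℂ) + k * Complex.I) b,
      cfc_id' ℂ b, cfc_const _ b, Algebra.algebraMap_eq_smul_one]
  rw [h1]
  refine norm_cfc_le (Real.sqrt_nonneg _) fun w hw ↦ ?_
  have hw0 : 0 ≤ w := spectrum_nonneg_of_nonneg hb hw
  have hwn : ‖w‖ ≤ ‖b‖ := by
    have : Nontrivial B := by
      by_contra hB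
      rw [not_nontrivial_iff_subsingleton] at hB
      simp [spectrum.of_subsingleton] at hw
    exact spectrum.norm_le_norm_of_mem hw
  obtain ⟨r, hr, rfl⟩ : ∃ r : ℝ, 0 ≤ r ∧ (r : ℂ) = w :=
    ⟨w.re, (Complex.nonneg_iff.mp hw0).1, by
      apply Complex.ext
      · simp
      · simpa using (Complex.nonneg_iff.mp hw0).2⟩
  rw [Complex.norm_real, Real.norm_of_nonneg hr] at hwn
  rw [Complex.norm_def]
  refine Real.sqrt_le_sqrt ?_
  simp only [Complex.normSq_apply, Complex.sub_re, Complex.sub_im, Complex.add_re,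
    Complex.add_im, Complex.mul_re, Complex.mul_im, Complex.ofReal_re, Complex.ofReal_im,
    Complex.I_re, Complex.I_im]
  nlinarith

/-- `g b` lies in every disk centred at `‖b‖/2 + ik` whose circle passes through `0` and `‖b‖`; over
all real `k` these disks meet only in `[0, ‖b‖]`. -/
theorem CStarAlgebra.nonneg_of_norm_le_one_of_map_one {g : B →L[ℂ] ℂ} (hg : ‖g‖ ≤ 1)
    (h1 : g 1 = 1) {b : B} (hb : 0 ≤ b) : 0 ≤ g b := by
  set c := ‖b‖ / 2 with hc
  have hc0 : 0 ≤ c := by positivity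
  have key (k : ℝ) : ((g b).re - c) ^ 2 + ((g b).im - k) ^ 2 ≤ c ^ 2 + k ^ 2 := by
    have h2 : ‖g (b - ((c : ℂ) + k * Complex.I) • (1 : B))‖ ≤ √(c ^ 2 + k ^ 2) :=
      ((g.le_of_opNorm_le hg _).trans_eq (one_mul _)).trans
        (CStarAlgebra.norm_sub_smul_one_le hb k)
    rw [map_sub, map_smul, h1, Complex.norm_def] at h2
    have h3 := (Real.sqrt_le_sqrt_iff (by positivity)).mp h2
    simp [Complex.normSq_apply] at h3
    nlinarith
  have him : (g b).im = 0 := by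
    by_contra hne
    -- With this `k`, `2k · im = c² + 1`, so the disk for `-k` excludes `g b`.
    have h2 := key ((c ^ 2 + 1) / (2 * (g b).im))
    have h3 : (g b).im * ((c ^ 2 + 1) / (2 * (g b).im)) = (c ^ 2 + 1) / 2 := by
      field_simp
    have h4 := key (-((c ^ 2 + 1) / (2 * (g b).im)))
    have h5 : 0 < (g b).im ^ 2 := by positivity
    generalize (c ^ 2 + 1) / (2 * (g b).im) = k at *
    nlinarith [sq_nonneg ((g b).re - c)]
  have hre : 0 ≤ (g b).re := by
    have h2 := key 0
    rw [him] at h2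
    nlinarith
  exact Complex.nonneg_iff.mpr ⟨hre, him.symm⟩

/-- A functional norming `1 + a` must norm `1` and `a` separately, because `‖1 + a‖ = 1 + ‖a‖`. -/
theorem CStarAlgebra.exists_state_apply_eq_norm [Nontrivial B] {a : B} (ha : 0 ≤ a) :
    ∃ ω : B →ₚ[ℂ] ℂ, ω 1 = 1 ∧ ω a = ‖a‖ := by
  obtain ⟨g, hg, hga⟩ := exists_dual_vector'' ℂ (1 + a)
  rw [map_add, CStarAlgebra.norm_one_add_of_nonneg ha] at hga
  have h1 : ‖g 1‖ ≤ 1 := (g.le_of_opNorm_le hg 1).trans_eq (by simp)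
  have h2 : ‖g a‖ ≤ ‖a‖ := (g.le_of_opNorm_le hg a).trans_eq (by simp)
  have hre := congrArg Complex.re hga
  rw [Complex.add_re] at hre
  replace hre : (g 1).re + (g a).re = 1 + ‖a‖ := hre
  have h3 := Complex.re_le_norm (g 1)
  have h4 := Complex.re_le_norm (g a)
  have hg1 : g 1 = 1 := by
    have h5 : (g 1).re = ‖g 1‖ := by linarith
    have h6 : 0 ≤ g 1 := Complex.re_eq_norm.mp h5
    have h7 : ((g 1).re : ℂ) = g 1 := by
      rw [h5]; exact Complex.norm_of_nonneg' h6
    rw [← h7]; norm_cast; linarith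
  refine ⟨.mk₀ g.toLinearMap fun b hb ↦
    CStarAlgebra.nonneg_of_norm_le_one_of_map_one hg hg1 hb, hg1, ?_⟩
  have : g a = ‖a‖ := by
    rw [hg1] at hga
    push_cast at hga
    exact add_left_cancel hga
  exact this

end CStarAlgebra

/-! ### Direct sums and completions of semi-inner product spaces -/

section Hilbert

open scoped InnerProductSpace

theorem PreInnerProductSpace.Core.inner_zero_left {W : Type*} [AddCommGroup W] [Module ℂ W]
    (c : PreInnerProductSpace.Core ℂ W) (a : W) : c.inner 0 a = 0 := by
  have := c.smul_left 0 a 0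
  simpa using this

theorem PreInnerProductSpace.Core.inner_zero_right {W : Type*} [AddCommGroup W] [Module ℂ W]
    (c : PreInnerProductSpace.Core ℂ W) (a : W) : c.inner a 0 = 0 := by
  rw [← c.conj_inner_symm, c.inner_zero_left, map_zero]

/-- The direct sum of copies of `W` with semi-inner products given by `c`. -/
noncomputable abbrev Finsupp.preInnerProductSpaceCore {ι W : Type*} [AddCommGroup W] [Module ℂ W]
    (c : ι → PreInnerProductSpace.Core ℂ W) : PreInnerProductSpace.Core ℂ (ι →₀ W) where
  inner v w := v.sum fun i a ↦ (c i).inner a (w i)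
  conj_inner_symm v w := by
    classical
    rw [Finsupp.sum, map_sum]
    simp only [(c _).conj_inner_symm]
    rw [Finset.sum_subset (Finset.subset_union_left (s₂ := v.support)),
      Finsupp.sum_of_support_subset v (Finset.subset_union_right (s₁ := w.support))]
    · intro i _; exact (c i).inner_zero_left _
    · intro i _ hi
      rw [Finsupp.notMem_support_iff.mp hi, (c i).inner_zero_right]
  re_inner_nonneg v := by
    rw [Finsupp.sum, map_sum]
    exact Finset.sum_nonneg fun i _ ↦ (c i).re_inner_nonneg _
  add_left v w z := by
    classical
    exact Finsupp.sum_add_index' (fun i ↦ (c i).inner_zero_left _)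
      fun _ _ _ ↦ (c _).add_left _ _ _
  smul_left v w r := by
    refine (Finsupp.sum_smul_index' (b := r) (g := v)
      (h := fun i a ↦ (c i).inner a (w i)) fun i ↦ (c i).inner_zero_left _).trans ?_
    simp only [(c _).smul_left]
    rw [Finsupp.sum, Finsupp.sum, Finset.mul_sum]

theorem Finsupp.preInnerProductSpaceCore_inner {ι W : Type*} [AddCommGroup W] [Module ℂ W]
    (c : ι → PreInnerProductSpace.Core ℂ W) (v w : ι →₀ W) :
    (Finsupp.preInnerProductSpaceCore c).inner v w = v.sum fun i a ↦ (c i).inner a (w i) := rfl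

section mapRange

variable {ι W : Type*} [AddCommGroup W] [Module ℂ W] (c : ι → PreInnerProductSpace.Core ℂ W)

theorem Finsupp.preInnerProductSpaceCore_inner_mapRange (f : W →ₗ[ℂ] W) (v w : ι →₀ W) :
    (Finsupp.preInnerProductSpaceCore c).inner (Finsupp.mapRange.linearMap f v) w
      = v.sum fun i a ↦ (c i).inner (f a) (w i) := by
  rw [Finsupp.preInnerProductSpaceCore_inner, Finsupp.mapRange.linearMap_apply]
  exact Finsupp.sum_mapRange_index (h := fun i a ↦ (c i).inner a (w i))
    fun i ↦ (c i).inner_zero_left _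

theorem Finsupp.preInnerProductSpaceCore_mapRange_adjoint {f g : W →ₗ[ℂ] W}
    (h : ∀ i a b, (c i).inner (g a) b = (c i).inner a (f b)) (v w : ι →₀ W) :
    (Finsupp.preInnerProductSpaceCore c).inner (Finsupp.mapRange.linearMap g v) w
      = (Finsupp.preInnerProductSpaceCore c).inner v (Finsupp.mapRange.linearMap f w) := by
  rw [Finsupp.preInnerProductSpaceCore_inner_mapRange, Finsupp.preInnerProductSpaceCore_inner]
  exact Finsupp.sum_congr fun i _ ↦ h i _ _

theorem Finsupp.preInnerProductSpaceCore_mapRange_le {f : W →ₗ[ℂ] W} {M : ℝ}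
    (h : ∀ i a, ((c i).inner (f a) (f a)).re ≤ M * ((c i).inner a a).re) (v : ι →₀ W) :
    ((Finsupp.preInnerProductSpaceCore c).inner (Finsupp.mapRange.linearMap f v)
        (Finsupp.mapRange.linearMap f v)).re
      ≤ M * ((Finsupp.preInnerProductSpaceCore c).inner v v).re := by
  rw [Finsupp.preInnerProductSpaceCore_inner_mapRange, Finsupp.preInnerProductSpaceCore_inner,
    Finsupp.sum, Finsupp.sum, Complex.re_sum, Complex.re_sum, Finset.mul_sum]
  exact Finset.sum_le_sum fun i _ ↦ h i _

end mapRange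

/-- Bounded operators on a space with a semi-inner product, together with formal adjoints, extend
to the Hilbert space completion. -/
theorem PreInnerProductSpace.Core.exists_completion {V X : Type u} [AddCommGroup V] [Module ℂ V]
    (c : PreInnerProductSpace.Core ℂ V) (π ρ : X → V →ₗ[ℂ] V) (M : X → ℝ) (hM : ∀ x, 0 ≤ M x)
    (hadj : ∀ x v w, c.inner (ρ x v) w = c.inner v (π x w))
    (hle : ∀ x v, (c.inner (π x v) (π x v)).re ≤ M x ^ 2 * (c.inner v v).re) :
    ∃ (H : Type u) (_ : NormedAddCommGroup H) (_ : InnerProductSpace ℂ H) (_ : CompleteSpace H)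
      (j : V →ₗ[ℂ] H) (T : X → H →L[ℂ] H), DenseRange j ∧
      (∀ v w, ⟪j v, j w⟫_ℂ = c.inner v w) ∧ (∀ x v, T x (j v) = j (π x v)) ∧
      (∀ x v, star (T x) (j v) = j (ρ x v)) ∧ ∀ x, ‖T x‖ ≤ M x := by
  -- Null vectors need no separate quotient: the completion is Hausdorff.
  let _ : SeminormedAddCommGroup V := InnerProductSpace.Core.toSeminormedAddCommGroup (c := c)
  let _ : InnerProductSpace ℂ V := InnerProductSpace.ofCore c
  have hinner (v w : V) : ⟪v, w⟫_ℂ = c.inner v w := rfl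
  have hnorm (v : V) : ‖v‖ ^ 2 = (c.inner v v).re := by
    rw [← hinner, ← inner_self_eq_norm_sq (𝕜 := ℂ)]; rfl
  have hbound (x : X) (v : V) : ‖π x v‖ ≤ M x * ‖v‖ := by
    refine (pow_le_pow_iff_left₀ (norm_nonneg _) (mul_nonneg (hM x) (norm_nonneg _))
      two_ne_zero).mp ?_
    rw [mul_pow, hnorm, hnorm]
    exact hle x v
  let S (x : X) : V →L[ℂ] V := (π x).mkContinuous (M x) (hbound x)
  let j : V →L[ℂ] UniformSpace.Completion V := UniformSpace.Completion.toComplL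
  have hj : DenseRange j := UniformSpace.Completion.denseRange_coe
  have hjinner (v w : V) : ⟪j v, j w⟫_ℂ = c.inner v w :=
    (UniformSpace.Completion.inner_coe v w).trans (hinner v w)
  have hjnorm (v : V) : ‖j v‖ = ‖v‖ := UniformSpace.Completion.norm_coe v
  have hS (x : X) (v : V) : (S x).completion (j v) = j (π x v) :=
    (S x).completion_apply_coe v
  refine ⟨UniformSpace.Completion V, inferInstance, inferInstance, inferInstance, j.toLinearMap,
    fun x ↦ (S x).completion, hj, hjinner, hS, fun x v ↦ ?_, fun x ↦ ?_⟩
  · refine ext_inner_right ℂ fun w ↦ ?_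
    rw [ContinuousLinearMap.star_eq_adjoint, ContinuousLinearMap.adjoint_inner_left]
    refine hj.induction_on w (isClosed_eq (by fun_prop) (by fun_prop)) fun w ↦ ?_
    rw [hS]
    exact (hjinner _ _).trans ((hadj x v w).symm.trans (hjinner _ _).symm)
  · refine ContinuousLinearMap.opNorm_le_bound _ (hM x) fun w ↦ ?_
    refine hj.induction_on w (isClosed_le (by fun_prop) (by fun_prop)) fun w ↦ ?_
    rw [hS, hjnorm, hjnorm]
    exact hbound x w

end Hilbert

/-! ### GNS representation of the positive part -/

namespace IsCStarTernaryRing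

variable {A : Type u} [NormedAddCommGroup A] [NormedSpace ℂ A] [CompleteSpace A]
  {t : A → A → A → A} (ht : IsCStarTernaryRing t)

open Adjointable
open scoped ComplexOrder InnerProductSpace

/-- The semi-inner product on `Adjointable × positivePart` that a positive functional induces. -/
noncomputable abbrev stateCore (ω : ht.Adjointable →ₚ[ℂ] ℂ) :
    PreInnerProductSpace.Core ℂ (ht.Adjointable × ht.positivePart) where
  inner a b := ω (b.1 * star a.1) + ω (ht.pairing b.2 a.2)
  conj_inner_symm a b := by
    simp [← Complex.star_def, ← map_star ω, star_pairing]
  re_inner_nonneg a := (Complex.nonneg_iff.mp (add_nonneg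
    (ω.map_nonneg (mul_star_self_nonneg _)) (ω.map_nonneg a.2.2))).1
  add_left a b c := by
    simp only [Prod.fst_add, Prod.snd_add, star_add, mul_add, map_add, Submodule.coe_add,
      pairing_add_right]
    ring
  smul_left a b r := by
    simp only [Prod.smul_fst, Prod.smul_snd, star_smul, mul_smul_comm, map_smul,
      Submodule.coe_smul, pairing_smul_right, smul_eq_mul, Complex.star_def]
    ring

theorem stateCore_inner (ω : ht.Adjointable →ₚ[ℂ] ℂ) (a b : ht.Adjointable × ht.positivePart) :
    (ht.stateCore ω).inner a b = ω (b.1 * star a.1) + ω (ht.pairing b.2 a.2) := rfl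

/-- The map `(T, z) ↦ (0, T x)`. -/
noncomputable def act (x : ht.positivePart) :
    ht.Adjointable × ht.positivePart →ₗ[ℂ] ht.Adjointable × ht.positivePart where
  toFun a := (0, ⟨val ht a.1 x, IsPositive.map x.2 a.1⟩)
  map_add' a b := by ext <;> simp
  map_smul' c a := by ext <;> simp

/-- The map `(T, z) ↦ ([z x ·], 0)`. -/
noncomputable def coact (x : ht.positivePart) :
    ht.Adjointable × ht.positivePart →ₗ[ℂ] ht.Adjointable × ht.positivePart where
  toFun a := (ht.pairing a.2 x, 0)
  map_add' a b := by ext <;> simp [pairing_add_left]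
  map_smul' c a := by ext <;> simp [pairing_smul_left]

theorem pairing_zero_left (x : A) : ht.pairing 0 x = 0 := by
  have := ht.pairing_smul_left 0 0 x
  simpa using this

theorem pairing_zero_right (x : A) : ht.pairing x 0 = 0 := by
  rw [← star_pairing, pairing_zero_left, star_zero]

theorem nontrivial_adjointable {x : A} (hx : x ≠ 0) : Nontrivial ht.Adjointable :=
  ⟨ht.pairing x x, 0, mt ht.pairing_self_eq_zero hx⟩

theorem stateCore_coact_left (ω : ht.Adjointable →ₚ[ℂ] ℂ) (x : ht.positivePart)
    (a b : ht.Adjointable × ht.positivePart) :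
    (ht.stateCore ω).inner (ht.coact x a) b = (ht.stateCore ω).inner a (ht.act x b) := by
  simp [stateCore_inner, act, coact, star_pairing, mul_pairing, pairing_zero_right]

/-- Apply `ω` to `T⟨x,x⟩T* ≤ ‖x‖² TT*`; the second summand of the form is nonnegative because its
vectors are positive. -/
theorem stateCore_act_self_le (ω : ht.Adjointable →ₚ[ℂ] ℂ) (x : ht.positivePart)
    (a : ht.Adjointable × ht.positivePart) :
    ((ht.stateCore ω).inner (ht.act x a) (ht.act x a)).re
      ≤ ‖x‖ ^ 2 * ((ht.stateCore ω).inner a a).re := by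
  have h1 : ω (ht.pairing (val ht a.1 x) (val ht a.1 x))
      ≤ ω ((‖x‖ ^ 2 : ℝ) • (a.1 * star a.1)) := by
    refine OrderHomClass.mono ω ?_
    rw [pairing_map_map, Submodule.coe_norm, ← ht.norm_pairing_self]
    exact CStarAlgebra.star_right_conjugate_le_norm_smul (ht.isSelfAdjoint_pairing _)
  have h2 := (Complex.le_def.mp h1).1
  rw [← Complex.coe_smul, map_smul, smul_eq_mul, Complex.re_ofReal_mul] at h2
  have h3 := (Complex.nonneg_iff.mp (ω.map_nonneg a.2.2)).1
  simp only [stateCore_inner, act, LinearMap.coe_mk, AddHom.coe_mk, zero_mul, map_zero, zero_add,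
    Complex.add_re]
  nlinarith [sq_nonneg ‖x‖]

/-- Since `x` acts by `T ↦ Tx`, a multiplication from the right, factors come out reversed. Summing
over all `ω` makes the map isometric: if `ω` is a state with `ω⟨x,x⟩ = ‖x‖²`, the unit vector `(1,
0)` at `ω` is sent to norm `‖x‖`. -/
theorem exists_linearIsometry_antimultiplicative :
    ∃ (H : Type u) (_ : NormedAddCommGroup H) (_ : InnerProductSpace ℂ H) (_ : CompleteSpace H)
      (φ : ht.positivePart →ₗᵢ[ℂ] (H →L[ℂ] H)), ∀ x y z w : ht.positivePart,
      (w : A) = t x y z → φ w = φ z * star (φ y) * φ x := by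
  obtain ⟨H, _, _, _, j, T, hj, hinner, hT, hT', hnorm⟩ :=
    (Finsupp.preInnerProductSpaceCore ht.stateCore).exists_completion
      (fun x : ht.positivePart ↦ Finsupp.mapRange.linearMap (ht.act x))
      (fun x ↦ Finsupp.mapRange.linearMap (ht.coact x)) (fun x ↦ ‖x‖) (fun x ↦ norm_nonneg x)
      (fun x ↦ Finsupp.preInnerProductSpaceCore_mapRange_adjoint ht.stateCore
        fun ω ↦ ht.stateCore_coact_left ω x)
      (fun x ↦ Finsupp.preInnerProductSpaceCore_mapRange_le ht.stateCore
        fun ω ↦ ht.stateCore_act_self_le ω x)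
  have hext {S S' : H →L[ℂ] H} (h : ∀ v, S (j v) = S' (j v)) : S = S' :=
    ContinuousLinearMap.coeFn_injective (hj.equalizer S.continuous S'.continuous (funext h))
  have hadd (x y : ht.positivePart) : T (x + y) = T x + T y := hext fun v ↦ by
    rw [add_apply, hT, hT, hT, ← map_add]
    congr 1
    ext ω <;> simp [act]
  have hsmul (r : ℂ) (x : ht.positivePart) : T (r • x) = r • T x := hext fun v ↦ by
    rw [smul_apply, hT, hT, ← map_smul]
    congr 1
    ext ω <;> simp [act]
  let φ₀ : ht.positivePart →ₗ[ℂ] (H →L[ℂ] H) :=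
    { toFun := T, map_add' := hadd, map_smul' := hsmul }
  refine ⟨H, _, _, inferInstance, ⟨φ₀, fun x ↦ le_antisymm (hnorm x) ?_⟩, fun x y z w hw ↦ ?_⟩
  · rcases eq_or_ne x 0 with rfl | hx
    · simp
    have := ht.nontrivial_adjointable (x := x) (by simpa using hx)
    obtain ⟨ω, hω1, hω⟩ := CStarAlgebra.exists_state_apply_eq_norm (a := ht.pairing x x) x.2
    have hj1 (a : ht.Adjointable × ht.positivePart) :
        ‖j (Finsupp.single ω a)‖ ^ 2 = ((ht.stateCore ω).inner a a).re := by
      rw [← inner_self_eq_norm_sq (𝕜 := ℂ), hinner, Finsupp.preInnerProductSpaceCore_inner,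
        Finsupp.sum_single_index, Finsupp.single_eq_same]
      · rfl
      · exact (ht.stateCore ω).inner_zero_left _
    have h1 : ‖j (Finsupp.single ω (1, 0))‖ = 1 := by
      have := hj1 (1, 0)
      rw [stateCore_inner] at this
      simp only [star_one, mul_one, hω1, Submodule.coe_zero, pairing_zero_right, map_zero,
        add_zero, Complex.one_re] at this
      exact (pow_eq_one_iff_of_nonneg (norm_nonneg _) two_ne_zero).mp this
    have h2 : ‖T x (j (Finsupp.single ω (1, 0)))‖ = ‖x‖ := by
      rw [hT]
      have := hj1 (ht.act x (1, 0))
      rw [← sq_eq_sq₀ (norm_nonneg _) (norm_nonneg _), Finsupp.mapRange.linearMap_apply,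
        Finsupp.mapRange_single, this]
      simp only [stateCore_inner, act, LinearMap.coe_mk, AddHom.coe_mk, zero_mul, map_zero, map_one,
        one_apply_eq_self, hω, norm_pairing_self, zero_add, Complex.ofReal_re]
      rfl
    calc ‖x‖ = ‖T x (j (Finsupp.single ω (1, 0)))‖ := h2.symm
      _ ≤ ‖T x‖ * 1 := h1 ▸ (T x).le_opNorm _
      _ = ‖T x‖ := mul_one _
  · refine hext fun v ↦ ?_
    change T w (j v) = T z (star (T y) (T x (j v)))
    rw [hT, hT, hT', hT]
    congr 1
    ext ω
    · simp [act, coact]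
    · simp [act, coact, hw, map_left]

end IsCStarTernaryRing

/-! ### Existence of the decomposition and location of arbitrary ones -/

theorem isAntiIsomorphicToTRO_iff {A : Type u} [NormedAddCommGroup A] [NormedSpace ℂ A]
    {t : A → A → A → A} {P : Submodule ℂ A} :
    IsAntiIsomorphicToTRO t P ↔ IsIsomorphicToTRO (fun x y z ↦ -t x y z) P := by
  constructor
  · rintro ⟨hP, H, _, _, _, B, hB, φ, hφ⟩
    refine ⟨⟨hP.isClosed, fun x hx y hy z hz ↦ P.neg_mem (hP.mem x hx y hy z hz)⟩,
      H, _, _, inferInstance, B, hB, φ, fun x y z ↦ ?_⟩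
    rw [← neg_neg ((φ x : H →L[ℂ] H) * _ * _), ← hφ, ← Submodule.coe_neg, ← map_neg]
    rfl
  · rintro ⟨hP, H, _, _, _, B, hB, φ, hφ⟩
    refine ⟨⟨hP.isClosed, fun x hx y hy z hz ↦ by
        have := P.neg_mem (hP.mem x hx y hy z hz)
        rwa [neg_neg] at this⟩,
      H, _, _, inferInstance, B, hB, φ, fun x y z ↦ ?_⟩
    rw [← hφ, ← Submodule.coe_neg, ← map_neg]
    congr 2
    ext
    simp

namespace IsCStarTernaryRing

variable {A : Type u} [NormedAddCommGroup A] [NormedSpace ℂ A] [CompleteSpace A]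
  {t : A → A → A → A} (ht : IsCStarTernaryRing t)

open Adjointable

theorem positivePart_op : ht.op.positivePart = ht.positivePart :=
  Submodule.ext fun x ↦ ht.isPositive_op_iff x

theorem isIsomorphicToTRO_positivePart : IsIsomorphicToTRO t ht.positivePart := by
  have hP := ht.isSubCStarTernaryRing_positivePart
  -- Representing the reversed product restores the order of factors, and its positive part is the
  -- same.
  have hex := ht.op.exists_linearIsometry_antimultiplicative
  rw [ht.positivePart_op] at hex
  obtain ⟨H, _, _, _, φ, hφ⟩ := hex
  have : CompleteSpace ht.positivePart := hP.isClosed.completeSpace_coe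
  refine ⟨hP, H, _, _, inferInstance, LinearMap.range φ.toLinearMap, ⟨?_, ?_⟩, φ.equivRange,
    fun x y z ↦ hφ z y x _ rfl⟩
  · exact φ.isometry.isClosedEmbedding.isClosed_range
  · rintro _ ⟨x, rfl⟩ _ ⟨y, rfl⟩ _ ⟨z, rfl⟩
    exact ⟨⟨t x y z, hP.mem x x.2 y y.2 z z.2⟩, hφ z y x _ rfl⟩

theorem isZettlDecomposition : IsZettlDecomposition t ht.positivePart ht.negativePart where
  isCompl := ht.isCompl_positivePart_negativePart
  pos := ht.isIsomorphicToTRO_positivePart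
  neg := isAntiIsomorphicToTRO_iff.mpr ht.neg.isIsomorphicToTRO_positivePart

/-- In `B(H)` the iterates become `(‖x‖² - XX*)ⁿ X`, and `XX* ≥ 0` bounds them; the norm criterion
carries this back to `A`. -/
theorem le_positivePart {P : Submodule ℂ A} (hP : IsIsomorphicToTRO t P) :
    P ≤ ht.positivePart := by
  obtain ⟨hP, H, _, _, _, B, -, φ, hφ⟩ := hP
  intro x hx
  rw [mem_positivePart, isPositive_iff_norm_damped_le]
  set X : H →L[ℂ] H := (φ ⟨x, hx⟩ : H →L[ℂ] H) with hX
  have hXnorm : ‖X‖ = ‖x‖ := φ.norm_map ⟨x, hx⟩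
  have hS : ‖algebraMap ℝ (H →L[ℂ] H) (‖x‖ ^ 2) - X * star X‖ ≤ ‖x‖ ^ 2 := by
    refine CStarAlgebra.norm_algebraMap_sub_le (mul_star_self_nonneg X) ?_
    rw [CStarRing.norm_self_mul_star, hXnorm, sq]
  have key (n : ℕ) : ∃ d : P, (d : A) = damped t x n ∧ ‖d‖ ≤ (‖x‖ ^ 2) ^ n * ‖x‖ := by
    induction n with
    | zero => exact ⟨⟨x, hx⟩, rfl, by simp⟩
    | succ n ih =>
      obtain ⟨d, hd, hdn⟩ := ih
      refine ⟨((‖x‖ ^ 2 : ℝ) : ℂ) • d - ⟨t x x d, hP.mem x hx x hx d d.2⟩, ?_, ?_⟩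
      · rw [damped_succ, ← hd]; rfl
      · rw [← φ.norm_map, map_sub, map_smul, Submodule.coe_norm, Submodule.coe_sub,
          Submodule.coe_smul, hφ ⟨x, hx⟩ ⟨x, hx⟩ d, ← hX]
        have h1 : ((‖x‖ ^ 2 : ℝ) : ℂ) • (φ d : H →L[ℂ] H) - X * star X * φ d
            = (algebraMap ℝ (H →L[ℂ] H) (‖x‖ ^ 2) - X * star X) * φ d := by
          rw [sub_mul, Algebra.algebraMap_eq_smul_one, smul_mul_assoc, one_mul, Complex.coe_smul]
        have h2 : ‖(φ d : H →L[ℂ] H)‖ = ‖d‖ := φ.norm_map d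
        rw [h1, pow_succ' _ n, mul_assoc (‖x‖ ^ 2)]
        refine (norm_mul_le _ _).trans ?_
        rw [h2]
        gcongr
  intro n
  obtain ⟨d, hd, hdn⟩ := key n
  rw [← hd]
  exact hdn

theorem le_negativePart {N : Submodule ℂ A} (hN : IsAntiIsomorphicToTRO t N) :
    N ≤ ht.negativePart :=
  ht.neg.le_positivePart (isAntiIsomorphicToTRO_iff.mp hN)

end IsCStarTernaryRing

/-! ### Contractive exponentials, hermitian operators and spectra -/

section Exponential

theorem CStarAlgebra.norm_exp_smul_le_one {B : Type*} [CStarAlgebra B] [PartialOrder B]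
    [StarOrderedRing B] {b : B} (hb : 0 ≤ b) {c : ℂ} (hc : c.re ≤ 0) :
    ‖NormedSpace.exp (c • b)‖ ≤ 1 := by
  open scoped ComplexOrder in
  have hn : IsStarNormal b := (IsSelfAdjoint.of_nonneg hb).isStarNormal
  have hn' : IsStarNormal (c • b) := inferInstance
  rw [← CFC.complex_exp_eq_normedSpace_exp, ← cfc_comp_const_mul c Complex.exp b]
  refine norm_cfc_le zero_le_one fun w hw ↦ ?_
  have hw0 := Complex.nonneg_iff.mp (spectrum_nonneg_of_nonneg hb hw)
  rw [Complex.norm_exp, Real.exp_le_one_iff, Complex.mul_re, ← hw0.2, mul_zero, sub_zero]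
  exact mul_nonpos_of_nonpos_of_nonneg hc hw0.1

variable {A : Type*} [NormedAddCommGroup A] [NormedSpace ℂ A] [CompleteSpace A]

/-- Spectral mapping gives `|exp(cz)| ≤ 1`, so `Re(cz) ≤ 0`; take `c = i, -i, -1`. -/
theorem spectrum.exists_nonneg_of_norm_exp_le_one {D : A →L[ℂ] A}
    (h : ∀ c : ℂ, c.re ≤ 0 → ‖NormedSpace.exp (c • D)‖ ≤ 1) {z : ℂ} (hz : z ∈ spectrum ℂ D) :
    ∃ r : ℝ, 0 ≤ r ∧ z = r := by
  have hA : Nontrivial A := by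
    by_contra hA
    rw [not_nontrivial_iff_subsingleton] at hA
    simp [spectrum.of_subsingleton] at hz
  have key (c : ℂ) (hc0 : c ≠ 0) (hc : c.re ≤ 0) : (c * z).re ≤ 0 := by
    have h1 : c * z ∈ spectrum ℂ (c • D) :=
      spectrum.smul_mem_smul_iff (r := Units.mk0 c hc0).mpr hz
    have h2 := spectrum.norm_le_norm_of_mem (spectrum.exp_mem_exp _ h1)
    rw [← Complex.exp_eq_exp_ℂ, Complex.norm_exp] at h2
    exact Real.exp_le_one_iff.mp (h2.trans (h c hc))
  have h1 := key Complex.I Complex.I_ne_zero (by simp)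
  have h2 := key (-Complex.I) (neg_ne_zero.mpr Complex.I_ne_zero) (by simp)
  have h3 := key (-1) (by norm_num) (by simp)
  simp at h1 h2 h3
  refine ⟨z.re, h3, Complex.ext rfl ?_⟩
  simpa using le_antisymm h2 h1

/-- On the imaginary axis both the exponential and its inverse are contractions. -/
theorem isHermitianOperator_of_norm_exp_le_one {A : Type u} [NormedAddCommGroup A]
    [NormedSpace ℂ A] [CompleteSpace A] {D : A →L[ℂ] A}
    (h : ∀ c : ℂ, c.re ≤ 0 → ‖NormedSpace.exp (c • D)‖ ≤ 1) : IsHermitianOperator D := by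
  intro s
  rcases subsingleton_or_nontrivial A with hA | hA
  · rw [Subsingleton.elim (NormedSpace.exp _) (ContinuousLinearMap.id ℂ A)]
  rw [ContinuousLinearMap.norm_id]
  refine le_antisymm (h _ (by simp)) ?_
  let _ : NormedAlgebra ℚ (A →L[ℂ] A) := .restrictScalars ℚ ℂ _
  have h1 : NormedSpace.exp ((Complex.I * s) • D) * NormedSpace.exp ((-(Complex.I * s)) • D)
      = 1 := by
    rw [← NormedSpace.exp_add_of_commute, ← add_smul, add_neg_cancel, zero_smul,
      NormedSpace.exp_zero]
    exact ((Commute.refl D).smul_left _).smul_right _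
  calc (1 : ℝ) = ‖NormedSpace.exp ((Complex.I * s) • D)
        * NormedSpace.exp ((-(Complex.I * s)) • D)‖ := by rw [h1, norm_one]
    _ ≤ ‖NormedSpace.exp ((Complex.I * s) • D)‖ * 1 :=
      (norm_mul_le _ _).trans (by gcongr; exact h _ (by simp))
    _ = _ := mul_one _

theorem IsSelfAdjoint.le_norm_pow {B : Type*} [CStarAlgebra B] [Nontrivial B] {b : B}
    (hb : IsSelfAdjoint b) (n : ℕ) : ‖b‖ ^ n ≤ ‖b ^ n‖ := by
  have aux {s : ℝ} (hs : s ∈ spectrum ℝ b) : |s| ^ n ≤ ‖b ^ n‖ := by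
    have := spectrum.norm_le_norm_of_mem (spectrum.pow_mem_pow b n hs)
    rwa [norm_pow, Real.norm_eq_abs] at this
  rcases CStarAlgebra.norm_or_neg_norm_mem_spectrum hb with h | h
  · simpa using aux h
  · simpa using aux h

end Exponential

/-! ### The symmetrized product -/

namespace IsCStarTernaryRing

variable {A : Type u} [NormedAddCommGroup A] [NormedSpace ℂ A] [CompleteSpace A]
  {t : A → A → A → A} (ht : IsCStarTernaryRing t)

open Adjointable

/-- The operator `z ↦ {x x z}` of the symmetrized product. -/
noncomputable def box (x : A) : A →L[ℂ] A :=
  (1 / 2 : ℂ) • (ht.leftMul x x + ht.op.leftMul x x)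

theorem box_apply (x z : A) : ht.box x z = symmetrizedProduct t x x z := by
  simp [box, symmetrizedProduct]

theorem box_neg (x : A) : ht.neg.box x = -ht.box x := by
  ext z
  simp [box]
  abel

theorem norm_box (x : A) : ‖ht.box x‖ = ‖x‖ ^ 2 := by
  refine le_antisymm ?_ ?_
  · rw [box, norm_smul]
    have h1 := ht.norm_leftMul_le x x
    have h2 := ht.op.norm_leftMul_le x x
    have h3 := norm_add_le (ht.leftMul x x) (ht.op.leftMul x x)
    norm_num
    nlinarith
  · rcases eq_or_ne x 0 with rfl | hx
    · simp
    have h1 := (ht.box x).le_opNorm x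
    have h2 : ht.box x x = t x x x := by
      rw [box_apply, symmetrizedProduct, ← two_smul ℂ, smul_smul]; norm_num
    rw [h2, ht.norm_cube, pow_succ] at h1
    exact le_of_mul_le_mul_right h1 (norm_pos_iff.mpr hx)

theorem commute_leftMul_op (x : A) : Commute (ht.leftMul x x) (ht.op.leftMul x x) := by
  ext z
  exact (ht.assoc_right x x z x x).symm

theorem norm_exp_smul_leftMul_le {x : A} (hx : ht.IsPositive x) {c : ℂ} (hc : c.re ≤ 0) :
    ‖NormedSpace.exp (c • ht.leftMul x x)‖ ≤ 1 := by
  let _ : NormedAlgebra ℚ ht.Adjointable := .restrictScalars ℚ ℂ _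
  let _ : NormedAlgebra ℚ (A →L[ℂ] A) := .restrictScalars ℚ ℂ _
  have h := NormedSpace.map_exp (val ht) isometry_val.continuous (c • ht.pairing x x)
  rw [map_smul, val_pairing] at h
  rw [← h, norm_val]
  exact CStarAlgebra.norm_exp_smul_le_one hx hc

/-- Left and right multiplication commute, so the exponential factors into two contractions at
`c/2`; the right one uses the left-right symmetry of positivity. -/
theorem norm_exp_smul_box_le {x : A} (hx : ht.IsPositive x) (c : ℂ) (hc : c.re ≤ 0) :
    ‖NormedSpace.exp (c • ht.box x)‖ ≤ 1 := by
  let _ : NormedAlgebra ℚ (A →L[ℂ] A) := .restrictScalars ℚ ℂ _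
  have hc' : (c * (1 / 2)).re ≤ 0 := by
    simp; linarith
  rw [box, smul_smul, smul_add, NormedSpace.exp_add_of_commute
    (((ht.commute_leftMul_op x).smul_left _).smul_right _)]
  refine (norm_mul_le _ _).trans ?_
  exact mul_le_one₀ (ht.norm_exp_smul_leftMul_le hx hc') (norm_nonneg _)
    (ht.op.norm_exp_smul_leftMul_le ((ht.isPositive_op_iff x).mpr hx) hc')

theorem isJBStarTriple (h : ∀ x, ht.IsPositive x) : IsJBStarTriple (symmetrizedProduct t) where
  add_left x x' y z := by
    simp only [symmetrizedProduct, ht.add_left, ht.add_right]; module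
  smul_left c x y z := by
    simp only [symmetrizedProduct, ht.smul_left, ht.smul_right]; module
  add_middle x y y' z := by
    simp only [symmetrizedProduct, ht.add_middle]; module
  smul_middle c x y z := by
    simp only [symmetrizedProduct, ht.smul_middle]; module
  add_right x y z z' := by
    simp only [symmetrizedProduct, ht.add_left, ht.add_right]; module
  smul_right c x y z := by
    simp only [symmetrizedProduct, ht.smul_left, ht.smul_right]; module
  comm x y z := by rw [symmetrizedProduct, symmetrizedProduct, add_comm]
  jordan x y a b z := by
    -- With `assoc_right`, this brings all fivefold products to the form `[a b [c d e]]`, leaving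
    -- linear algebra.
    have hmid (a b c d e : A) : t a (t d c b) e = t a b (t c d e) :=
      (ht.assoc_middle a b c d e).symm.trans (ht.assoc_right a b c d e)
    have hhalf : starRingEnd ℂ (1 / 2) = 1 / 2 := by rw [map_div₀, map_one, map_ofNat]
    simp only [symmetrizedProduct, ht.add_left, ht.add_right, ht.add_middle, ht.smul_left,
      ht.smul_right, ht.smul_middle, ht.assoc_right, hmid, hhalf]
    module
  box x := ⟨ht.box x, ht.box_apply x, ht.norm_box x,
    isHermitianOperator_of_norm_exp_le_one (ht.norm_exp_smul_box_le (h x)),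
    fun _ hc ↦ spectrum.exists_nonneg_of_norm_exp_le_one (ht.norm_exp_smul_box_le (h x)) hc⟩

/-- On odd powers of `x` both halves of the symmetrized operator agree. -/
theorem box_pow_apply (x : A) (n : ℕ) : (ht.box x ^ n) x = val ht (ht.pairing x x ^ n) x := by
  have hcomm (n : ℕ) : t (val ht (ht.pairing x x ^ n) x) x x
      = t x x (val ht (ht.pairing x x ^ n) x) := by
    rw [← map_left (ht := ht), ← val_pairing_apply ht x x x, ← val_pairing_apply ht x x (val ht _ x),
      ← mul_apply_eq_comp, ← mul_apply_eq_comp, ← map_mul, ← map_mul, pow_mul_comm']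
  induction n with
  | zero => simp
  | succ n ih =>
    rw [pow_succ', mul_apply_eq_comp, ih, box_apply, symmetrizedProduct, hcomm, ← two_smul ℂ,
      smul_smul, pow_succ', map_mul, mul_apply_eq_comp, val_pairing_apply]
    norm_num

/-- Test on `x`: with `b = ⟨x,x⟩`, `‖bⁿx‖² = ‖bⁿ b bⁿ‖ = ‖b^(2n+1)‖`, and `b` is self-adjoint of
norm `‖x‖²`. -/
theorem le_norm_box_pow {x : A} (hx : x ≠ 0) (n : ℕ) : (‖x‖ ^ 2) ^ n ≤ ‖ht.box x ^ n‖ := by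
  have h1 := (ht.box x ^ n).le_opNorm x
  rw [box_pow_apply] at h1
  have h2 : (‖x‖ ^ 2) ^ (2 * n + 1) ≤ ‖val ht (ht.pairing x x ^ n) x‖ ^ 2 := by
    have hb := ht.isSelfAdjoint_pairing x
    have := ht.nontrivial_adjointable hx
    rw [norm_sq_val_apply, ← norm_pairing_self, (hb.pow n).star_eq]
    convert hb.le_norm_pow (2 * n + 1) using 2
    rw [← pow_succ, ← pow_add]
    congr 1
    ring
  have hx0 : 0 < ‖x‖ := norm_pos_iff.mpr hx
  refine le_of_mul_le_mul_right (le_trans ?_ h1) hx0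
  refine (pow_le_pow_iff_left₀ (by positivity) (norm_nonneg _) two_ne_zero).mp ?_
  refine le_trans (le_of_eq ?_) h2
  ring

/-- By Gelfand's formula the power bound makes the spectral radius at least `‖x‖²`. -/
theorem exists_mem_spectrum_box {x : A} (hx : x ≠ 0) : ∃ c ∈ spectrum ℂ (ht.box x), c ≠ 0 := by
  have : Nontrivial A := ⟨x, 0, hx⟩
  obtain ⟨c, hc, hr⟩ := spectrum.exists_nnnorm_eq_spectralRadius (ht.box x)
  refine ⟨c, hc, ?_⟩
  rintro rfl
  have hlim := spectrum.pow_norm_pow_one_div_tendsto_nhds_spectralRadius (ht.box x)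
  rw [← hr] at hlim
  have hge : ENNReal.ofReal (‖x‖ ^ 2) ≤ ((‖(0 : ℂ)‖₊ : NNReal) : ENNReal) := by
    refine ge_of_tendsto hlim ?_
    filter_upwards [Filter.eventually_ne_atTop 0] with n hn
    refine ENNReal.ofReal_le_ofReal ?_
    have h1 := Real.rpow_le_rpow (z := 1 / n) (by positivity) (ht.le_norm_box_pow hx n)
      (by positivity)
    rwa [one_div, Real.pow_rpow_inv_natCast (by positivity) hn, ← one_div] at h1
  have hx0 : 0 < ‖x‖ := norm_pos_iff.mpr hx
  simp at hge
  exact hx hge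

theorem negativePart_eq_bot (h : IsJBStarTriple (symmetrizedProduct t)) :
    ht.negativePart = ⊥ := by
  rw [eq_bot_iff]
  intro x hx
  by_contra hx0
  obtain ⟨D, hD, -, -, hspec⟩ := h.box x
  have hDbox : D = ht.box x := by ext z; rw [hD, box_apply]
  obtain ⟨c, hc, hc0⟩ := ht.exists_mem_spectrum_box (x := x) hx0
  obtain ⟨r, hr, rfl⟩ := hspec c (hDbox ▸ hc)
  -- `x` is positive for `-t`, whose operator is the negative of this one, so `-r ≥ 0` as well.
  have hc' : -(r : ℂ) ∈ spectrum ℂ (ht.neg.box x) := by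
    rw [box_neg, ← spectrum.neg_eq]
    simpa using hc
  obtain ⟨s, hs, hrs⟩ :=
    spectrum.exists_nonneg_of_norm_exp_le_one (ht.neg.norm_exp_smul_box_le hx) hc'
  norm_cast at hrs
  exact hc0 (by norm_cast; linarith)

end IsCStarTernaryRing

theorem mainTheorem6 {A : Type u} [NormedAddCommGroup A] [NormedSpace ℂ A] [CompleteSpace A]
    (t : A → A → A → A) (ht : IsCStarTernaryRing t) :
    (∃ P N : Submodule ℂ A, IsZettlDecomposition t P N) ∧
      ∀ P N : Submodule ℂ A, IsZettlDecomposition t P N →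
        (N = ⊥ ↔ IsJBStarTriple (symmetrizedProduct t)) := by
  refine ⟨⟨_, _, ht.isZettlDecomposition⟩, fun P N hPN ↦ ⟨fun hN ↦ ?_, fun h ↦ ?_⟩⟩
  · refine ht.isJBStarTriple fun x ↦ ht.le_positivePart hPN.pos ?_
    have hP : P = ⊤ := by simpa [hN] using hPN.isCompl.sup_eq_top
    rw [hP]
    trivial
  · exact eq_bot_iff.mpr ((ht.le_negativePart hPN.neg).trans (ht.negativePart_eq_bot h).le)
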